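/- Let $S_n$ be the symmetric group on $\{1,\dots,n\}$. All graphs are finite and undirected, and loops are disregarded; $\mathbb N$ denotes the positive integers. Consider the following graphs. - The proper power graph $P_0(S_n)$ has vertex set $S_n\setminus\{\mathrm{id}\}$; two distinct vertices are adjacent if one of them is a power of the other. - The proper quotient power graph $\widetilde P_0(S_n)$ is the quotient of $P_0(S_n)$ by the relation $\psi\sim\varphi\iff\langle\psi\rangle=\langle\varphi\rangle$. Its vertices are the classes $[\psi]$, $\psi\ne\mathrm{id}$, and two distinct classes are adjacent if they have adjacent representatives. - For a partition $T=[m_1,\dots,m_r]$ of $n$ and $a\in\mathbb N$, the power $T^a$ is the partition of $n$ obtained by replacing each term $m_i$ by $\gcd(a,m_i)$ terms equal to $m_i/\gcd(a,m_i)$. The type $T_\psi$ of $\psi\in S_n$ is the partition of $n$ formed by the lengths of the orbits of $\psi$. The proper power type graph $P_0(\mathcal T(S_n))$ has as vertices the types of the permutations in $S_n\setminus\{\mathrm{id}\}$; two distinct types are adjacent if one of them is a power of the other. - The proper order graph $\mathcal O_0(S_n)$ has as vertices the orders of the permutations in $S_n\setminus\{\mathrm{id}\}$; two distinct orders are adjacent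 if one of them divides the other. The maps $\tilde t([\psi])=T_\psi$ and $\tilde o([\psi])=o(\psi)$ are graph homomorphisms from $\widetilde P_0(S_n)$ to $P_0(\mathcal T(S_n))$ and to $\mathcal O_0(S_n)$, respectively. **Theorem D.** Let $n\ge 8$ with $n=p$ or $n=p+1$ for some prime $p$, and let $\widetilde\Delta_n$ be the component of $\widetilde P_0(S_n)$ containing $[(1\,2)]$. (i) $\widetilde P_0(S_n)$ consists of the main component $\widetilde\Delta_n$, whose vertices are the $[\psi]$ with $\psi\in S_n\setminus\{\mathrm{id}\}$ not a $p$-cycle, and of $(n-2)!$ (if $n=p$) or $n(n-3)!$ (if $n=p+1$) further components, each reduced to an isolated vertex. (ii) $P_0(S_n)$ consists of the main component induced by $\{\psi\in S_n\setminus\{\mathrm{id}\}:[\psi]\in V_{\widetilde\Delta_n}\}$, whose vertices are the non-identity permutations other than the $p$-cycles, and of $(n-2)!$ (if $n=p$) or $n(n-3)!$ (if $n=p+1$) further components, each of which is a complete graph on $p-1$ vertices, all of them $p$-cycles. (iii) $P_0(\mathcal T(S_n))$ consists of the main component $\tilde t(\widetilde\Delta_n)$ (the image subgraph), which contains $T_\psi$,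 for $\psi\in S_n\setminus\{\mathrm{id}\}$, exactly when $\psi$ is not a $p$-cycle, and of exactly one further component, reduced to the isolated vertex $[p]$ (if $n=p$) or $[1,p]$ (if $n=p+1$). (iv) $\mathcal O_0(S_n)$ consists of the main component $\tilde o(\widetilde\Delta_n)$ (the image subgraph), whose vertices are the orders, other than $p$, of the elements of $S_n\setminus\{\mathrm{id}\}$, and of exactly one further component, reduced to the isolated vertex $p$. In each of (i)-(iv) the main component is not a complete graph. -/

import Mathlib

namespace PowerGraphs

/-! Graphs are loopless `SimpleGraph`s: the loop that some authors put on every vertex is dropped. -/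

/-- The power graph of a group: distinct elements are adjacent when one of them is a positive
power of the other. -/
def powerGraph (G : Type*) [Group G] : SimpleGraph G :=
  SimpleGraph.fromRel fun x y => ∃ m : ℕ, 0 < m ∧ y = x ^ m

/-- The proper power graph: the identity is deleted. -/
def properPowerGraph (G : Type*) [Group G] : SimpleGraph ({1}ᶜ : Set G) :=
  (powerGraph G).induce {1}ᶜ

/-- `x ∼ y` when `x` and `y` generate the same cyclic subgroup. -/
def cyclicSetoid (G : Type*) [Group G] : Setoid G :=
  Setoid.ker fun x : G => Subgroup.zpowers x

/-- The set of classes `[x]`. -/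
abbrev CyclicClass (G : Type*) [Group G] : Type _ := Quotient (cyclicSetoid G)

/-- The class `[x]` of `x`. -/
def cls {G : Type*} [Group G] (x : G) : CyclicClass G := Quotient.mk (cyclicSetoid G) x

/-- The quotient power graph: distinct classes are adjacent when they have adjacent
representatives in the power graph. -/
def quotientPowerGraph (G : Type*) [Group G] : SimpleGraph (CyclicClass G) :=
  (powerGraph G).map cls

/-- The proper quotient power graph: the class of the identity is deleted. -/
def properQuotientPowerGraph (G : Type*) [Group G] :
    SimpleGraph ({cls 1}ᶜ : Set (CyclicClass G)) :=
  (quotientPowerGraph G).induce {cls 1}ᶜ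

theorem cls_eq_iff {G : Type*} [Group G] {x y : G} :
    cls x = cls y ↔ Subgroup.zpowers x = Subgroup.zpowers y :=
  Quotient.eq (r := cyclicSetoid G)

theorem cls_eq_one_iff {G : Type*} [Group G] {x : G} : cls x = cls 1 ↔ x = 1 := by
  rw [cls_eq_iff, Subgroup.zpowers_one_eq_bot, Subgroup.zpowers_eq_bot]

/-- The projection `x ↦ [x]` on the vertices of the proper graphs. -/
def properCls {G : Type*} [Group G] (x : ({1}ᶜ : Set G)) : ({cls 1}ᶜ : Set (CyclicClass G)) :=
  ⟨cls x.1, fun h => x.2 (cls_eq_one_iff.1 h)⟩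

/-- Natural numbers, distinct ones being adjacent when one divides the other. -/
def divisibilityGraph : SimpleGraph ℕ := SimpleGraph.fromRel fun a b => a ∣ b

/-- The proper order graph of a group: its vertices are the orders, different from `1`, of the
elements of the group. -/
def properOrderGraph (G : Type*) [Group G] :
    SimpleGraph (Set.range (fun x : G => orderOf x) \ {1} : Set ℕ) :=
  divisibilityGraph.induce (Set.range (fun x : G => orderOf x) \ {1})

theorem zpowers_pow_eq_of_orderOf_eq {G : Type*} [Group G] [Finite G] (y : G) (m : ℕ)
    (h : orderOf (y ^ m) = orderOf y) : Subgroup.zpowers (y ^ m) = Subgroup.zpowers y := by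
  apply Subgroup.eq_of_le_of_card_ge
  · rw [Subgroup.zpowers_le]
    exact Subgroup.npow_mem_zpowers y m
  · rw [Nat.card_zpowers, Nat.card_zpowers, h]

/-- The order of a class. -/
noncomputable def clsOrder {G : Type*} [Group G] : CyclicClass G → ℕ :=
  Quotient.lift (s := cyclicSetoid G) (fun x => orderOf x) fun x y h => by
    have h' : Subgroup.zpowers x = Subgroup.zpowers y := h
    rw [← Nat.card_zpowers x, ← Nat.card_zpowers y, h']

/-- The order map `[x] ↦ o(x)`, as a homomorphism from the proper quotient power graph to the
proper order graph. -/
noncomputable def orderHom (G : Type*) [Group G] [Finite G] :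
    properQuotientPowerGraph G →g properOrderGraph G where
  toFun c := ⟨clsOrder c.1, by
    obtain ⟨c, hc⟩ := c
    induction c using Quotient.inductionOn with
    | h x =>
      refine ⟨⟨x, rfl⟩, fun h => hc ?_⟩
      exact cls_eq_one_iff.2 (orderOf_eq_one_iff.1 h)⟩
  map_rel' := by
    rintro ⟨c, hc⟩ ⟨d, hd⟩ ⟨hne, x, y, hxy, hx, hy⟩
    subst hx hy
    obtain ⟨-, h⟩ := hxy
    refine ⟨fun he => hne ?_, ?_⟩
    · have he' : orderOf x = orderOf y := he
      change cls x = cls y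
      rw [cls_eq_iff]
      rcases h with ⟨m, -, rfl⟩ | ⟨m, -, rfl⟩
      · exact (zpowers_pow_eq_of_orderOf_eq x m he'.symm).symm
      · exact zpowers_pow_eq_of_orderOf_eq y m he'
    · rcases h with ⟨m, -, rfl⟩ | ⟨m, -, rfl⟩
      · exact Or.inr (orderOf_pow_dvd m)
      · exact Or.inl (orderOf_pow_dvd m)

/-- The power `T ^ a` of a partition: each term `m` is replaced by `gcd (a, m)` terms equal to
`m / gcd (a, m)`. -/
def partitionPow {n : ℕ} (T : n.Partition) (a : ℕ) : n.Partition where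
  parts := T.parts.bind fun m => Multiset.replicate (Nat.gcd a m) (m / Nat.gcd a m)
  parts_pos := by
    intro i hi
    obtain ⟨m, hm, hi⟩ := Multiset.mem_bind.1 hi
    rw [Multiset.eq_of_mem_replicate hi]
    have hm0 := T.parts_pos hm
    exact Nat.div_pos (Nat.le_of_dvd hm0 (Nat.gcd_dvd_right a m)) (Nat.gcd_pos_of_pos_right a hm0)
  parts_sum := by
    rw [Multiset.sum_bind]
    have h : T.parts.map (fun m => (Multiset.replicate (Nat.gcd a m) (m / Nat.gcd a m)).sum)
        = T.parts.map id := by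
      refine Multiset.map_congr rfl fun m _ => ?_
      rw [Multiset.sum_replicate, smul_eq_mul, Nat.mul_div_cancel' (Nat.gcd_dvd_right a m), id]
    rw [h, Multiset.map_id, T.parts_sum]

/-- The trivial partition `[1 ^ n]`. -/
def trivialPartition (n : ℕ) : n.Partition where
  parts := Multiset.replicate n 1
  parts_pos := fun h => by rw [Multiset.eq_of_mem_replicate h]; exact one_pos
  parts_sum := by simp

/-- The type of a permutation of `n` points: the partition of `n` given by the lengths of its
orbits, fixed points included. -/
def permType {n : ℕ} (σ : Equiv.Perm (Fin n)) : n.Partition where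
  parts := σ.partition.parts
  parts_pos := σ.partition.parts_pos
  parts_sum := σ.partition.parts_sum.trans (Fintype.card_fin n)

/-- Partitions of `n`, distinct ones being adjacent when one is a positive power of the other. -/
def partitionPowerGraph (n : ℕ) : SimpleGraph n.Partition :=
  SimpleGraph.fromRel fun T T' => ∃ a : ℕ, 0 < a ∧ T' = partitionPow T a

/-- The proper power type graph of the symmetric group of degree `n`: its vertices are the types
of the permutations, the trivial one excluded. -/
def properTypeGraph (n : ℕ) :
    SimpleGraph (Set.range (permType (n := n)) \ {trivialPartition n} : Set n.Partition) :=
  (partitionPowerGraph n).induce (Set.range (permType (n := n)) \ {trivialPartition n})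

section TypeFacts

variable {n : ℕ}

theorem minimalPeriod_eq (σ : Equiv.Perm (Fin n)) {x : Fin n} (hx : x ∈ σ.support) :
    Function.minimalPeriod σ x = (σ.cycleOf x).support.card := by
  have hc : (σ.cycleOf x).IsCycle :=
    Equiv.Perm.isCycle_cycleOf σ (Equiv.Perm.mem_support.1 hx)
  have hxs : x ∈ (σ.cycleOf x).support := by
    rw [Equiv.Perm.mem_support_cycleOf_iff]
    exact ⟨Equiv.Perm.SameCycle.refl _ _, hx⟩
  refine Nat.dvd_right_iff_eq.1 fun k => ?_
  rw [← Function.isPeriodicPt_iff_minimalPeriod_dvd, Function.IsPeriodicPt,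
    Function.IsFixedPt, ← hc.orderOf, orderOf_dvd_iff_pow_eq_one,
    hc.pow_eq_one_iff' (Equiv.Perm.mem_support.1 hxs), Equiv.Perm.iterate_eq_pow,
    Equiv.Perm.cycleOf_pow_apply_self]

theorem sum_minimalPeriod (σ : Equiv.Perm (Fin n)) (g : ℕ → ℕ) :
    ∑ x, g (Function.minimalPeriod σ x)
      = ((permType σ).parts.map fun m => m * g m).sum := by
  classical
  have hparts : (permType σ).parts
      = σ.cycleType + Multiset.replicate (Fintype.card (Fin n) - σ.support.card) 1 :=
    Equiv.Perm.parts_partition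
  rw [hparts, Multiset.map_add, Multiset.sum_add, Multiset.map_replicate,
    Multiset.sum_replicate, Equiv.Perm.cycleType_def, Multiset.map_map,
    ← Finset.sum_add_sum_compl σ.support]
  congr 1
  · rw [← Finset.sum_fiberwise_of_maps_to (s := σ.support) (t := σ.cycleFactorsFinset)
      (g := fun x => σ.cycleOf x)
      (fun x hx => Equiv.Perm.cycleOf_mem_cycleFactorsFinset_iff.2 hx)]
    change _ = ∑ c ∈ σ.cycleFactorsFinset, c.support.card * g c.support.card
    refine Finset.sum_congr rfl fun c hc => ?_
    have hfib : {x ∈ σ.support | σ.cycleOf x = c} = c.support := by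
      ext x
      rw [Finset.mem_filter]
      constructor
      · rintro ⟨hx, rfl⟩
        rw [Equiv.Perm.mem_support_cycleOf_iff]
        exact ⟨Equiv.Perm.SameCycle.refl _ _, hx⟩
      · intro hx
        exact ⟨Equiv.Perm.mem_cycleFactorsFinset_support_le hc hx,
          (Equiv.Perm.cycle_is_cycleOf hx hc).symm⟩
    rw [hfib, ← smul_eq_mul, ← Finset.sum_const]
    refine Finset.sum_congr rfl fun x hx => ?_
    rw [minimalPeriod_eq σ (Equiv.Perm.mem_cycleFactorsFinset_support_le hc hx),
      ← Equiv.Perm.cycle_is_cycleOf hx hc]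
  · rw [smul_eq_mul, one_mul, ← smul_eq_mul, ← Finset.card_compl, ← Finset.sum_const]
    refine Finset.sum_congr rfl fun x hx => ?_
    rw [Finset.mem_compl, Equiv.Perm.notMem_support] at hx
    rw [Function.minimalPeriod_eq_one_iff_isFixedPt.2 hx]

theorem partition_eq_of_sum (T T' : n.Partition)
    (h : ∀ g : ℕ → ℕ, (T.parts.map fun m => m * g m).sum = (T'.parts.map fun m => m * g m).sum) :
    T = T' := by
  have key : ∀ (s : Multiset ℕ) (k : ℕ),
      (s.map fun m => m * (if m = k then 1 else 0)).sum = k * s.count k := by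
    intro s k
    induction s using Multiset.induction_on with
    | empty => simp
    | cons a s ih =>
      rw [Multiset.map_cons, Multiset.sum_cons, ih, Multiset.count_cons]
      by_cases hak : a = k
      · subst hak; simp; ring
      · simp [hak, Ne.symm hak]
  refine Nat.Partition.ext (Multiset.ext.2 fun k => ?_)
  rcases Nat.eq_zero_or_pos k with rfl | hk
  · rw [Multiset.count_eq_zero_of_notMem fun h0 => (T.parts_pos h0).ne' rfl,
      Multiset.count_eq_zero_of_notMem fun h0 => (T'.parts_pos h0).ne' rfl]
  · have := h fun m => if m = k then 1 else 0
    rw [key, key] at this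
    exact Nat.eq_of_mul_eq_mul_left hk this

theorem permType_pow (σ : Equiv.Perm (Fin n)) {a : ℕ} (ha : 0 < a) :
    permType (σ ^ a) = partitionPow (permType σ) a := by
  refine partition_eq_of_sum _ _ fun g => ?_
  rw [← sum_minimalPeriod]
  have h1 : ∀ x, Function.minimalPeriod (σ ^ a : Equiv.Perm (Fin n)) x
      = Function.minimalPeriod σ x / Nat.gcd a (Function.minimalPeriod σ x) := by
    intro x
    have := Function.minimalPeriod_iterate_eq_div_gcd (f := σ) (x := x) ha.ne'
    rw [Nat.gcd_comm, ← this, Equiv.Perm.iterate_eq_pow]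
  simp only [h1]
  rw [sum_minimalPeriod σ fun m => g (m / Nat.gcd a m)]
  change _ = (((permType σ).parts.bind fun m =>
    Multiset.replicate (Nat.gcd a m) (m / Nat.gcd a m)).map fun m => m * g m).sum
  rw [Multiset.map_bind, Multiset.sum_bind]
  congr 1
  refine Multiset.map_congr rfl fun m _ => ?_
  rw [Multiset.map_replicate, Multiset.sum_replicate, smul_eq_mul, ← mul_assoc,
    Nat.mul_div_cancel' (Nat.gcd_dvd_right a m)]

theorem orderOf_eq_of_permType_eq {σ τ : Equiv.Perm (Fin n)} (h : permType σ = permType τ) :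
    orderOf σ = orderOf τ := by
  have hp : σ.partition = τ.partition := Nat.Partition.ext (congrArg (fun T => T.parts) h :)
  obtain ⟨c, hc⟩ := isConj_iff.1 (Equiv.Perm.partition_eq_of_isConj.2 hp)
  rw [← Equiv.Perm.lcm_cycleType, ← Equiv.Perm.lcm_cycleType, ← hc, Equiv.Perm.cycleType_conj]

theorem permType_one : permType (1 : Equiv.Perm (Fin n)) = trivialPartition n := by
  refine Nat.Partition.ext ?_
  change (1 : Equiv.Perm (Fin n)).partition.parts = Multiset.replicate n 1
  rw [Equiv.Perm.parts_partition]
  simp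

theorem permType_eq_trivial_iff {σ : Equiv.Perm (Fin n)} :
    permType σ = trivialPartition n ↔ σ = 1 := by
  constructor
  · intro h
    rw [← permType_one] at h
    rw [← orderOf_eq_one_iff, orderOf_eq_of_permType_eq h, orderOf_one]
  · rintro rfl
    exact permType_one

theorem permType_eq_of_zpowers_eq {σ τ : Equiv.Perm (Fin n)}
    (h : Subgroup.zpowers σ = Subgroup.zpowers τ) : permType σ = permType τ := by
  have hsame : ∀ (ρ : Equiv.Perm (Fin n)) (x : Fin n), Function.minimalPeriod ρ x
      = Nat.card (MulAction.orbit (Subgroup.zpowers ρ) x) := by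
    intro ρ x
    have := Fintype.ofFinite (MulAction.orbit (Subgroup.zpowers ρ) x)
    rw [Nat.card_eq_fintype_card]
    exact MulAction.minimalPeriod_eq_card (a := ρ) (b := x)
  refine partition_eq_of_sum _ _ fun g => ?_
  rw [← sum_minimalPeriod, ← sum_minimalPeriod]
  refine Finset.sum_congr rfl fun x _ => ?_
  rw [hsame, hsame, h]

end TypeFacts

/-- The type of a class of permutations. -/
def clsType {n : ℕ} : CyclicClass (Equiv.Perm (Fin n)) → n.Partition :=
  Quotient.lift (s := cyclicSetoid (Equiv.Perm (Fin n))) permType fun _ _ h =>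
    permType_eq_of_zpowers_eq h

/-- The type map `[ψ] ↦ T_ψ`, as a homomorphism from the proper quotient power graph of the
symmetric group to its proper power type graph. -/
def typeHom (n : ℕ) :
    properQuotientPowerGraph (Equiv.Perm (Fin n)) →g properTypeGraph n where
  toFun c := ⟨clsType c.1, by
    obtain ⟨c, hc⟩ := c
    induction c using Quotient.inductionOn with
    | h x =>
      refine ⟨⟨x, rfl⟩, fun h => hc ?_⟩
      exact cls_eq_one_iff.2 (permType_eq_trivial_iff.1 h)⟩
  map_rel' := by
    rintro ⟨c, hc⟩ ⟨d, hd⟩ ⟨hne, x, y, hxy, hx, hy⟩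
    subst hx hy
    obtain ⟨-, h⟩ := hxy
    refine ⟨fun he => hne ?_, ?_⟩
    · have he' : orderOf x = orderOf y := orderOf_eq_of_permType_eq he
      change cls x = cls y
      rw [cls_eq_iff]
      rcases h with ⟨m, -, rfl⟩ | ⟨m, -, rfl⟩
      · exact (zpowers_pow_eq_of_orderOf_eq x m he'.symm).symm
      · exact zpowers_pow_eq_of_orderOf_eq y m he'
    · rcases h with ⟨m, hm, rfl⟩ | ⟨m, hm, rfl⟩
      · exact Or.inl ⟨m, hm, permType_pow x hm⟩
      · exact Or.inr ⟨m, hm, permType_pow y hm⟩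

/-- `ψ` is a cycle of length `k`. -/
def IsKCycle {n : ℕ} (k : ℕ) (ψ : Equiv.Perm (Fin n)) : Prop :=
  ψ.IsCycle ∧ ψ.support.card = k

/-- The vertex `(1 2)` of the proper power graph; the points are numbered from `0` here. -/
def transposition (n : ℕ) (hn : 2 ≤ n) : ({1}ᶜ : Set (Equiv.Perm (Fin n))) :=
  ⟨Equiv.swap ⟨0, by omega⟩ ⟨1, by omega⟩, fun h => by
    have h' := Equiv.swap_eq_one_iff.1 h
    exact absurd (congrArg Fin.val h') Nat.zero_ne_one⟩

/-- The component of the proper quotient power graph of the symmetric group that contains the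
class of `(1 2)`. -/
def mainComponent (n : ℕ) (hn : 2 ≤ n) :
    (properQuotientPowerGraph (Equiv.Perm (Fin n))).ConnectedComponent :=
  (properQuotientPowerGraph (Equiv.Perm (Fin n))).connectedComponentMk
    (properCls (transposition n hn))

end PowerGraphs

namespace PowerGraphs

/-! ### Linked elements of a group, and the passage between the power graph and its quotient. -/

section Group

variable {G : Type*} [Group G]

/-! Two nontrivial commuting elements of coprime orders are joined through their product, since each
is a power of it (`linked_of_commute_of_coprime`). This leads every non-identity permutation other
than a `p`-cycle to a transposition. Some power of it has prime order `q`, and `q ≠ p` because for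
`n ≤ p + 1` an element whose order is divisible by `p` is a `p`-cycle (`isKCycle_of_dvd_orderOf`).
An involution commutes with an element of order 3 moving at most 6 points, and as `n ≥ 8` a
transposition fits beside it. For `q` odd, a single `q`-cycle misses two points by parity, and a
product of several `q`-cycles commutes with an involution. Any two transpositions are joined through
a 3-cycle disjoint from both.

Conversely, a neighbour of a `p`-cycle in the proper power graph generates the same subgroup
(`zpowers_eq_of_linked_isKCycle`). So the `p`-cycles split off as the sets of generators of
subgroups of order `p`, and their number is the number of `p`-cycles divided by `p - 1`.

Edges of the type graph and of the order graph lift to the quotient power graph, so the main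
component maps onto a component there, while all `p`-cycles have one image, which is isolated
(`components_of_image`). Elements of order 2 and 3 are never adjacent, so no main component is
complete. -/

/-- Two elements lie in the same component of the proper power graph. -/
def Linked (x y : G) : Prop :=
  ∃ (hx : x ∈ ({1}ᶜ : Set G)) (hy : y ∈ ({1}ᶜ : Set G)),
    (properPowerGraph G).Reachable ⟨x, hx⟩ ⟨y, hy⟩

theorem linked_coe_iff {x y : ({1}ᶜ : Set G)} :
    Linked x.1 y.1 ↔ (properPowerGraph G).Reachable x y :=
  ⟨fun ⟨_, _, h⟩ => h, fun h => ⟨x.2, y.2, h⟩⟩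

theorem Linked.symm {x y : G} : Linked x y → Linked y x :=
  fun ⟨hx, hy, h⟩ => ⟨hy, hx, h.symm⟩

theorem Linked.trans {x y z : G} : Linked x y → Linked y z → Linked x z :=
  fun ⟨hx, _, h⟩ ⟨_, hz, h'⟩ => ⟨hx, hz, h.trans h'⟩

theorem linked_pow {x : G} {m : ℕ} (h : x ^ m ≠ 1) : Linked x (x ^ m) := by
  have hx : x ≠ 1 := by rintro rfl; simp at h
  refine ⟨hx, h, ?_⟩
  -- The graph has no loops, so a power equal to `x` itself has to be treated apart.
  by_cases he : x = x ^ m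
  · have : (⟨x, hx⟩ : ({1}ᶜ : Set G)) = ⟨x ^ m, h⟩ := Subtype.ext he
    rw [this]
  · refine SimpleGraph.Adj.reachable ⟨he, Or.inl ⟨m, ?_, rfl⟩⟩
    rcases Nat.eq_zero_or_pos m with rfl | hm
    · simp at h
    · exact hm

/-- Both elements are powers of `x * y`: raising it to `orderOf y` kills `y`, and by coprimality a
further power recovers `x`. -/
theorem linked_of_commute_of_coprime {x y : G} (hx : x ≠ 1) (hy : y ≠ 1) (h : Commute x y)
    (hc : (orderOf x).Coprime (orderOf y)) : Linked x y := by
  have key : ∀ {u v : G}, u ≠ 1 → Commute u v → (orderOf u).Coprime (orderOf v) →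
      Linked (u * v) u := by
    intro u v hu huv huc
    obtain ⟨m, hm⟩ := exists_pow_eq_self_of_coprime huc.symm
    have hm' : (u * v) ^ (orderOf v * m) = u := by
      rw [huv.mul_pow, pow_mul, pow_mul, pow_orderOf_eq_one, one_pow, mul_one, hm]
    have := linked_pow (x := u * v) (m := orderOf v * m) (by rwa [hm'])
    rwa [hm'] at this
  have h2 := key hy h.symm hc.symm
  rw [← h.eq] at h2
  exact (key hx h hc).symm.trans h2

theorem linked_of_zpowers_eq [Finite G] {x y : G} (hx : x ≠ 1)
    (h : Subgroup.zpowers x = Subgroup.zpowers y) : Linked x y := by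
  have hy : y ∈ Subgroup.zpowers x := h ▸ Subgroup.mem_zpowers y
  obtain ⟨m, rfl⟩ := (mem_powers_iff_mem_zpowers (x := x)).2 hy
  refine linked_pow fun h1 => hx ?_
  simp only at h1 h
  rwa [h1, Subgroup.zpowers_one_eq_bot, Subgroup.zpowers_eq_bot] at h

/-- Generators of one finite cyclic group are powers of each other, so the fibres of `properCls` are
connected. A walk of classes therefore lifts, changing representatives between edges, and a walk of
elements projects, some edges collapsing to points. -/
theorem reachable_properCls_iff [Finite G] {x y : ({1}ᶜ : Set G)} :
    (properQuotientPowerGraph G).Reachable (properCls x) (properCls y) ↔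
      (properPowerGraph G).Reachable x y := by
  constructor
  · suffices H : ∀ u v, (properQuotientPowerGraph G).Reachable u v →
        ∀ x y : ({1}ᶜ : Set G), properCls x = u → properCls y = v → Linked x.1 y.1 from
      fun h => linked_coe_iff.1 (H _ _ h x y rfl rfl)
    have hcls : ∀ x y : ({1}ᶜ : Set G), properCls x = properCls y → Linked x.1 y.1 :=
      fun x y h => linked_of_zpowers_eq x.2 (cls_eq_iff.1 (congrArg Subtype.val h))
    rintro u v ⟨w⟩
    induction w with
    | nil =>
      rintro x y rfl h
      exact hcls _ _ h.symm
    | @cons _ v' _ hadj _ ih =>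
      rintro x y rfl h
      obtain ⟨-, a, b, hab, ha, hb⟩ := hadj
      have ha1 : a ≠ 1 := by
        rintro rfl
        exact (properCls x).2 ha.symm
      have hb1 : b ≠ 1 := by
        rintro rfl
        exact v'.2 hb.symm
      have h1 := hcls x ⟨a, ha1⟩ (Subtype.ext ha.symm)
      have h2 : Linked a b := ⟨ha1, hb1, SimpleGraph.Adj.reachable hab⟩
      exact (h1.trans h2).trans (ih ⟨b, hb1⟩ y (Subtype.ext hb) h)
  · rintro ⟨w⟩
    induction w with
    | nil => rfl
    | @cons u v _ hadj _ ih =>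
      refine SimpleGraph.Reachable.trans ?_ ih
      by_cases he : properCls u = properCls v
      · rw [he]
      · refine SimpleGraph.Adj.reachable ?_
        exact ⟨fun h => he (Subtype.ext h), u.1, v.1, hadj, rfl, rfl⟩

theorem exists_properCls_eq (c : ({cls 1}ᶜ : Set (CyclicClass G))) :
    ∃ x, properCls x = c := by
  obtain ⟨c, hc⟩ := c
  induction c using Quotient.inductionOn with
  | h x =>
    refine ⟨⟨x, ?_⟩, rfl⟩
    rintro rfl
    exact hc rfl

/-- In a group of prime order every element but the identity is a generator. -/
theorem ncard_zpowers_eq {p : ℕ} (hp : p.Prime) {x : G} (hx : orderOf x = p) :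
    {y | Subgroup.zpowers y = Subgroup.zpowers x}.ncard = p - 1 := by
  have hfin : Finite (Subgroup.zpowers x) :=
    Nat.finite_of_card_ne_zero (by rw [Nat.card_zpowers, hx]; exact hp.ne_zero)
  have hset : {y | Subgroup.zpowers y = Subgroup.zpowers x}
      = (Subgroup.zpowers x : Set G) \ {1} := by
    ext y
    refine ⟨fun h => ⟨?_, ?_⟩, fun ⟨hy, hy1⟩ => ?_⟩
    · rw [← show Subgroup.zpowers y = Subgroup.zpowers x from h]
      exact Subgroup.mem_zpowers y
    · rintro rfl
      have h' : Subgroup.zpowers (1 : G) = Subgroup.zpowers x := h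
      rw [Subgroup.zpowers_one_eq_bot, eq_comm, Subgroup.zpowers_eq_bot,
        ← orderOf_eq_one_iff, hx] at h'
      exact hp.one_lt.ne' h'
    · have hle : Subgroup.zpowers y ≤ Subgroup.zpowers x := by rwa [Subgroup.zpowers_le]
      have hdvd : orderOf y ∣ p := by
        rw [← hx, ← Nat.card_zpowers, ← Nat.card_zpowers]
        exact Subgroup.card_dvd_of_le hle
      refine Subgroup.eq_of_le_of_card_ge hle ?_
      rw [Nat.card_zpowers, Nat.card_zpowers, hx]
      rcases (Nat.dvd_prime hp).1 hdvd with h | h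
      · exact absurd (orderOf_eq_one_iff.1 h) hy1
      · exact h.ge
  rw [hset, Set.ncard_sdiff_singleton_of_mem (one_mem (Subgroup.zpowers x)),
    ← Nat.card_coe_set_eq]
  have : Nat.card (Subgroup.zpowers x : Set G) = p := by
    rw [← hx, ← Nat.card_zpowers]
    rfl
  rw [this]

/-- Each fibre of `f` is the full set of `p - 1` generators of a subgroup of order `p`. The target
is abstract so that components of both the power graph and its quotient can be counted. -/
theorem card_mul_pred_of_fibers [Finite G] {p : ℕ} (hp : p.Prime) {S : Set G} {α : Type*}
    (f : S → α) (hf : Function.Surjective f)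
    (hS : ∀ x ∈ S, orderOf x = p)
    (hS' : ∀ x ∈ S, ∀ y, Subgroup.zpowers y = Subgroup.zpowers x → y ∈ S)
    (hfS : ∀ x y : S, f x = f y ↔ Subgroup.zpowers x.1 = Subgroup.zpowers y.1) :
    Nat.card α * (p - 1) = S.ncard := by
  have : Finite α := Finite.of_surjective f hf
  have : Fintype α := Fintype.ofFinite α
  rw [← Nat.card_coe_set_eq, ← Nat.card_congr (Equiv.sigmaFiberEquiv f), Nat.card_sigma,
    Finset.sum_const_nat (m := p - 1), Nat.card_eq_fintype_card, Finset.card_univ]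
  intro a _
  obtain ⟨x, rfl⟩ := hf a
  rw [← ncard_zpowers_eq hp (hS x.1 x.2), ← Nat.card_coe_set_eq]
  refine Nat.card_congr ⟨fun y => ⟨y.1.1, (hfS _ _).1 y.2⟩,
    fun y => ⟨⟨y.1, hS' x.1 x.2 y.1 y.2⟩, (hfS _ _).2 y.2⟩, fun _ => rfl, fun _ => rfl⟩

end Group

/-! ### Invariants along walks, and components under homomorphisms. -/

section Graph

variable {V W : Type*} {G : SimpleGraph V} {H : SimpleGraph W}

theorem reachable_invariant {P : V → Prop} (hP : ∀ v w, G.Adj v w → P v → P w) {v w : V}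
    (h : G.Reachable v w) (hv : P v) : P w := by
  obtain ⟨p⟩ := h
  induction p with
  | nil => exact hv
  | cons hadj _ ih => exact ih (hP _ _ hadj hv)

/-- Equality of vertex sets is not enough, since an image subgraph may lack edges of `H`. Lifting of
edges supplies them, and `hD` puts the lifted endpoints in `C`. -/
theorem toSubgraph_eq_map (f : G →g H) (C : G.ConnectedComponent) (D : H.ConnectedComponent)
    (hD : ∀ v, f v ∈ D.supp ↔ v ∈ C.supp) (hsurj : Function.Surjective f)
    (hadj : ∀ a b, H.Adj a b → ∃ v w, G.Adj v w ∧ f v = a ∧ f w = b) :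
    D.toSubgraph = C.toSubgraph.map f := by
  ext a b
  · constructor
    · intro ha
      obtain ⟨v, rfl⟩ := hsurj a
      exact ⟨v, (hD v).1 ha, rfl⟩
    · rintro ⟨v, hv, rfl⟩
      exact (hD v).2 hv
  · constructor
    · rintro ⟨ha, hb, h⟩
      obtain ⟨v, w, hvw, rfl, rfl⟩ := hadj _ _ h
      exact ⟨v, w, ⟨(hD v).1 ha, (hD w).1 hb, hvw⟩, rfl, rfl⟩
    · rintro ⟨v, w, ⟨hv, hw, h⟩, rfl, rfl⟩
      exact ⟨(hD v).2 hv, (hD w).2 hw, f.map_adj h⟩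

theorem toSimpleGraph_ne_top (C : G.ConnectedComponent) {v w : V} (hv : v ∈ C.supp)
    (hw : w ∈ C.supp) (hne : v ≠ w) (hadj : ¬ G.Adj v w) : C.toSimpleGraph ≠ ⊤ := by
  intro h
  refine hadj ?_
  rw [← C.toSimpleGraph_adj hv hw, h]
  exact fun he => hne (congrArg Subtype.val he)

end Graph

/-! ### Linking permutations of prime order to transpositions. -/

section Perm

open Equiv Equiv.Perm

variable {n : ℕ}

theorem exists_isSwap_disjoint (s : Finset (Fin n)) (hs : s.card + 2 ≤ n) :
    ∃ τ : Perm (Fin n), τ.IsSwap ∧ _root_.Disjoint τ.support s := by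
  have hc : 2 ≤ sᶜ.card := by
    rw [Finset.card_compl, Fintype.card_fin]
    omega
  obtain ⟨a, ha, b, hb, hab⟩ := Finset.one_lt_card.1 hc
  refine ⟨swap a b, ⟨a, b, hab, rfl⟩, ?_⟩
  rw [support_swap hab, Finset.disjoint_left]
  intro x hx
  rw [Finset.mem_compl] at ha hb
  rcases Finset.mem_insert.1 hx with rfl | hx
  · exact ha
  · rwa [Finset.mem_singleton.1 hx]

theorem exists_isThreeCycle_disjoint (s : Finset (Fin n)) (hs : s.card + 3 ≤ n) :
    ∃ τ : Perm (Fin n), τ.IsThreeCycle ∧ _root_.Disjoint τ.support s := by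
  have hc : 2 < sᶜ.card := by
    rw [Finset.card_compl, Fintype.card_fin]
    omega
  obtain ⟨a, b, c, ha, hb, hc, hab, hac, hbc⟩ := Finset.two_lt_card_iff.1 hc
  refine ⟨swap a b * swap a c, isThreeCycle_swap_mul_swap_same hab hac hbc, ?_⟩
  rw [Finset.disjoint_left]
  intro x hx
  rw [Finset.mem_compl] at ha hb hc
  have := support_mul_le _ _ hx
  simp only [support_swap hab, support_swap hac, Finset.sup_eq_union, Finset.mem_union,
    Finset.mem_insert, Finset.mem_singleton] at this
  rcases this with (rfl | rfl) | (rfl | rfl) <;> assumption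

theorem linked_of_disjoint_support {σ τ : Perm (Fin n)} (hσ : σ ≠ 1) (hτ : τ ≠ 1)
    (hd : _root_.Disjoint σ.support τ.support) (hc : (orderOf σ).Coprime (orderOf τ)) :
    Linked σ τ :=
  linked_of_commute_of_coprime hσ hτ (disjoint_iff_disjoint_support.2 hd).commute hc

theorem ne_one_of_orderOf_prime {G : Type*} [Group G] {x : G} (hx : (orderOf x).Prime) : x ≠ 1 := by
  rintro rfl
  rw [orderOf_one] at hx
  exact Nat.not_prime_one hx

/-- Two transpositions move at most 4 points, so 7 points leave room for a 3-cycle disjoint from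
both. -/
theorem linked_of_isSwap_of_isSwap (hn : 7 ≤ n) {σ τ : Perm (Fin n)} (hσ : σ.IsSwap)
    (hτ : τ.IsSwap) : Linked σ τ := by
  obtain ⟨ρ, hρ, hd⟩ := exists_isThreeCycle_disjoint (σ.support ∪ τ.support) (by
    have := Finset.card_union_le σ.support τ.support
    rw [card_support_eq_two.2 hσ, card_support_eq_two.2 hτ] at this
    omega)
  rw [Finset.disjoint_union_right] at hd
  have key : ∀ {α : Perm (Fin n)}, α.IsSwap → _root_.Disjoint ρ.support α.support → Linked ρ α := by
    intro α hα hd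
    refine linked_of_disjoint_support ?_ ?_ hd ?_
    · exact hρ.isCycle.ne_one
    · exact hα.isCycle.ne_one
    · rw [hρ.orderOf, hα.orderOf]
      norm_num
  exact (key hσ hd.1).symm.trans (key hτ hd.2)

theorem exists_isSwap_linked_of_odd {σ : Perm (Fin n)} (hσ : σ ≠ 1) (hs : σ.support.card + 2 ≤ n)
    (ho : Odd (orderOf σ)) : ∃ τ : Perm (Fin n), τ.IsSwap ∧ Linked σ τ := by
  obtain ⟨τ, hτ, hd⟩ := exists_isSwap_disjoint σ.support hs
  refine ⟨τ, hτ, linked_of_disjoint_support hσ hτ.isCycle.ne_one hd.symm ?_⟩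
  rw [hτ.orderOf]
  exact ho.coprime_two_right

/-- Take one point from each of three 2-cycles of `σ` and a 3-cycle `θ` on them. Conjugation by `σ`
exchanges `θ` with its disjoint conjugate, so it fixes their product, which has order 3 and moves 6
points. -/
theorem exists_isThreeCycle_commute_of_involution {σ : Perm (Fin n)} (hσ : σ * σ = 1)
    (hs : 6 ≤ σ.support.card) :
    ∃ ρ : Perm (Fin n), ρ.support.card ≤ 6 ∧ orderOf ρ = 3 ∧ Commute σ ρ := by
  have hσσ : ∀ x, σ (σ x) = x := fun x => by rw [← mul_apply, hσ, one_apply]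
  -- Used to choose `a`, `b`, `c` in distinct 2-cycles, avoiding at most 4 points each time.
  have hpick : ∀ s : Finset (Fin n), s.card ≤ 5 → ∃ x ∈ σ.support, x ∉ s := by
    intro s hs'
    by_contra! h
    have := Finset.card_le_card (show σ.support ⊆ s from h)
    omega
  obtain ⟨a, ha, -⟩ := hpick ∅ (by simp)
  obtain ⟨b, hb, hb'⟩ := hpick {a, σ a} (Finset.card_le_two.trans (by norm_num))
  obtain ⟨c, hc, hc'⟩ := hpick {a, σ a, b, σ b} (Finset.card_le_four.trans (by norm_num))
  simp only [Finset.mem_insert, Finset.mem_singleton, not_or] at hb' hc'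
  rw [mem_support] at ha hb hc
  obtain ⟨hba, hba'⟩ := hb'
  obtain ⟨hca, hca', hcb, hcb'⟩ := hc'
  have hθ : (swap a b * swap a c).IsThreeCycle :=
    isThreeCycle_swap_mul_swap_same (Ne.symm hba) (Ne.symm hca) (Ne.symm hcb)
  have hθs : (swap a b * swap a c).support ⊆ {a, b, c} := by
    intro x hx
    have := support_mul_le _ _ hx
    simp only [support_swap (Ne.symm hba), support_swap (Ne.symm hca), Finset.sup_eq_union,
      Finset.mem_union, Finset.mem_insert, Finset.mem_singleton] at this ⊢
    tauto
  set θ : Perm (Fin n) := swap a b * swap a c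
  have hinv : σ⁻¹ = σ := inv_eq_of_mul_eq_one_left hσ
  have hθs' : (σ * θ * σ⁻¹).support ⊆ {σ a, σ b, σ c} := by
    intro x hx
    rw [mem_support, mul_apply, mul_apply, hinv] at hx
    have hx' : σ x ∈ θ.support := by
      rw [mem_support]
      intro h
      rw [h, hσσ] at hx
      exact hx rfl
    have := hθs hx'
    simp only [Finset.mem_insert, Finset.mem_singleton] at this ⊢
    rw [← hσσ x]
    rcases this with h | h | h <;> simp [h]
  have hd : Perm.Disjoint θ (σ * θ * σ⁻¹) := by
    rw [disjoint_iff_disjoint_support]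
    refine Finset.disjoint_of_subset_left hθs (Finset.disjoint_of_subset_right hθs' ?_)
    have e : ∀ x y, x ≠ σ y → y ≠ σ x := fun x y h h' => h (by rw [h', hσσ])
    have := e _ _ hba'
    have := e _ _ hca'
    have := e _ _ hcb'
    simp only [Finset.disjoint_left, Finset.mem_insert, Finset.mem_singleton]
    grind
  have hcard := hθ.card_support
  have hcomm := hd.commute
  refine ⟨θ * (σ * θ * σ⁻¹), ?_, ?_, ?_⟩
  · rw [hd.card_support_mul, card_support_conj, hcard]
  · rw [hd.orderOf, hθ.orderOf, show σ * θ * σ⁻¹ = MulAut.conj σ θ from rfl,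
      MulEquiv.orderOf_eq, hθ.orderOf]
    rfl
  · rw [hinv] at hcomm ⊢
    change σ * (θ * (σ * θ * σ)) = θ * (σ * θ * σ) * σ
    have h := hcomm.eq
    simp only [mul_assoc] at h ⊢
    rw [h, hσ, mul_one, ← mul_assoc σ σ, hσ, one_mul]

theorem exists_isSwap_linked_of_orderOf_two (hn : 8 ≤ n) {σ : Perm (Fin n)}
    (hσ : orderOf σ = 2) : ∃ τ : Perm (Fin n), τ.IsSwap ∧ Linked σ τ := by
  have hσ1 : σ ≠ 1 := ne_one_of_orderOf_prime (hσ ▸ Nat.prime_two)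
  suffices ∃ ρ : Perm (Fin n), ρ.support.card ≤ 6 ∧ orderOf ρ = 3 ∧ Commute σ ρ by
    obtain ⟨ρ, hs, ho, hc⟩ := this
    have hρ1 : ρ ≠ 1 := ne_one_of_orderOf_prime (ho ▸ Nat.prime_three)
    obtain ⟨τ, hτ, hl⟩ := exists_isSwap_linked_of_odd hρ1 (by omega) (ho ▸ by decide)
    refine ⟨τ, hτ, (linked_of_commute_of_coprime hσ1 hρ1 hc ?_).trans hl⟩
    rw [hσ, ho]
    norm_num
  -- A support of at most 5 points leaves 3 of the `n ≥ 8` points free for a 3-cycle.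
  by_cases h : 6 ≤ σ.support.card
  · exact exists_isThreeCycle_commute_of_involution (by rw [← sq, ← hσ, pow_orderOf_eq_one]) h
  · obtain ⟨ρ, hρ, hd⟩ := exists_isThreeCycle_disjoint σ.support (by omega)
    refine ⟨ρ, by rw [hρ.card_support]; norm_num, hρ.orderOf, ?_⟩
    exact (disjoint_iff_disjoint_support.2 hd.symm).commute

/-! ### The role of the prime `p`: permutations of order divisible by `p`, and the count of cycles.
-/

theorem isKCycle_iff_cycleType {k : ℕ} {σ : Perm (Fin n)} (hk : 2 ≤ k) :
    IsKCycle k σ ↔ σ.cycleType = {k} := by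
  constructor
  · rintro ⟨h, rfl⟩
    exact h.cycleType
  · intro h
    refine ⟨card_cycleType_eq_one.1 (by rw [h]; rfl), ?_⟩
    rw [← sum_cycleType, h, Multiset.sum_singleton]

/-- The order is the lcm of the cycle lengths, so `p` divides one of them. That length is below `2 *
p`, hence equal to `p`, and the at most one remaining point cannot carry another nontrivial cycle.
-/
theorem isKCycle_of_dvd_orderOf {p : ℕ} (hp : p.Prime) (hn : n ≤ p + 1) {σ : Perm (Fin n)}
    (h : p ∣ orderOf σ) : IsKCycle p σ := by
  have key : ∀ s : Multiset ℕ, p ∣ s.lcm → ∃ m ∈ s, p ∣ m := by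
    intro s
    induction s using Multiset.induction_on with
    | empty => intro h; exact absurd (Nat.dvd_one.1 h) hp.ne_one
    | cons a s ih =>
      intro h
      rw [Multiset.lcm_cons] at h
      rcases hp.dvd_or_dvd_of_dvd_lcm h with h | h
      · exact ⟨a, Multiset.mem_cons_self a s, h⟩
      · obtain ⟨m, hm, h⟩ := ih h
        exact ⟨m, Multiset.mem_cons_of_mem hm, h⟩
  obtain ⟨m, hm, hpm⟩ := key σ.cycleType (by rwa [lcm_cycleType])
  rw [isKCycle_iff_cycleType hp.two_le]
  obtain ⟨t, ht⟩ := Multiset.exists_cons_of_mem hm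
  have hsum : m + t.sum ≤ n := by
    have := sum_cycleType_le σ
    rwa [ht, Multiset.sum_cons, Fintype.card_fin] at this
  have hm2 := two_le_of_mem_cycleType hm
  have hple := Nat.le_of_dvd (by omega) hpm
  have h2 := hp.two_le
  have hmp : m = p := by
    obtain ⟨k, rfl⟩ := hpm
    have hk0 : k ≠ 0 := by rintro rfl; omega
    have hk : k < 2 := by
      by_contra! hk
      have := Nat.mul_le_mul_left p hk
      omega
    rw [show k = 1 by omega, mul_one]
  have ht0 : t = 0 := by
    refine Multiset.eq_zero_of_forall_notMem fun k hk => ?_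
    have h1 := Multiset.single_le_sum (fun x _ => Nat.zero_le x) k hk
    have h3 : k ∈ σ.cycleType := ht ▸ Multiset.mem_cons_of_mem hk
    have := two_le_of_mem_cycleType h3
    omega
  rw [ht, ht0, hmp]
  rfl

theorem IsKCycle.orderOf {k : ℕ} {σ : Perm (Fin n)} (h : IsKCycle k σ) : orderOf σ = k :=
  h.1.orderOf.trans h.2

theorem isKCycle_iff_orderOf {p : ℕ} (hp : p.Prime) (hn : n ≤ p + 1) {σ : Perm (Fin n)} :
    IsKCycle p σ ↔ orderOf σ = p :=
  ⟨IsKCycle.orderOf, fun h => isKCycle_of_dvd_orderOf hp hn h.symm.dvd⟩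

theorem exists_isSwap_linked_of_orderOf_prime {p : ℕ} (hn : 8 ≤ n) (hp : p.Prime)
    (hnp : n = p ∨ n = p + 1) {σ : Perm (Fin n)} (hσ : (orderOf σ).Prime) (hσp : orderOf σ ≠ p) :
    ∃ τ : Perm (Fin n), τ.IsSwap ∧ Linked σ τ := by
  have hσ1 := ne_one_of_orderOf_prime hσ
  rcases hσ.eq_two_or_odd' with h2 | hodd
  · exact exists_isSwap_linked_of_orderOf_two hn h2
  · obtain ⟨k, hk⟩ := cycleType_prime_order hσ
    -- There are `k + 1` cycles, so `k = 0` means that `σ` is a single cycle.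
    rcases Nat.eq_zero_or_pos k with rfl | hk0
    · have hs : σ.support.card = orderOf σ := by
        rw [← sum_cycleType, hk]
        simp
      have hle : σ.support.card ≤ n := (Finset.card_le_univ _).trans (Fintype.card_fin n).le
      refine exists_isSwap_linked_of_odd hσ1 ?_ hodd
      -- The order of `σ` and `p` are distinct odd numbers, and the former is at most `n ≤ p + 1`.
      -- Hence it is at most `p - 2`, which leaves two fixed points.
      have hpo : p % 2 = 1 := by
        rcases hp.eq_two_or_odd with h | h <;> omega
      have := Nat.odd_iff.1 hodd
      omega
    · have hdvd : 2 ∣ Nat.card (Subgroup.centralizer {σ}) := by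
        rw [nat_card_centralizer]
        refine Dvd.dvd.mul_left ?_ _
        refine dvd_trans ?_ (Finset.dvd_prod_of_mem _ (a := _root_.orderOf σ) ?_)
        · rw [hk, Multiset.count_replicate_self]
          exact Nat.dvd_factorial (by norm_num) (by omega)
        · rw [hk]
          simp
      obtain ⟨⟨τ, hτ⟩, hτ2⟩ := exists_prime_orderOf_dvd_card' 2 hdvd
      rw [Subgroup.orderOf_mk] at hτ2
      have hc : Commute σ τ := Subgroup.mem_centralizer_singleton_iff.1 hτ |>.symm
      obtain ⟨ρ, hρ, hl⟩ := exists_isSwap_linked_of_orderOf_two hn hτ2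
      refine ⟨ρ, hρ, (linked_of_commute_of_coprime hσ1 ?_ hc ?_).trans hl⟩
      · exact ne_one_of_orderOf_prime (hτ2 ▸ Nat.prime_two)
      · rw [hτ2]
        exact hodd.coprime_two_right

theorem linked_of_not_isKCycle {p : ℕ} (hn : 8 ≤ n) (hp : p.Prime)
    (hnp : n = p ∨ n = p + 1) {σ τ : Perm (Fin n)} (hσ : σ ≠ 1) (hσp : ¬ IsKCycle p σ)
    (hτ : τ.IsSwap) : Linked τ σ := by
  obtain ⟨q, hq, hqd⟩ := Nat.exists_prime_and_dvd (mt orderOf_eq_one_iff.1 hσ)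
  obtain ⟨m, hm⟩ := hqd
  have hm0 : m ≠ 0 := by
    rintro rfl
    exact (orderOf_pos σ).ne' hm
  have ho : orderOf (σ ^ m) = q := by
    rw [orderOf_pow_of_dvd hm0 ⟨q, by rw [hm, mul_comm]⟩, hm,
      Nat.mul_div_cancel _ (Nat.pos_of_ne_zero hm0)]
  have hqp : q ≠ p := by
    rintro rfl
    exact hσp (isKCycle_of_dvd_orderOf hp (by omega) ⟨m, hm⟩)
  obtain ⟨ρ, hρ, hl⟩ := exists_isSwap_linked_of_orderOf_prime hn hp hnp (σ := σ ^ m)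
    (ho ▸ hq) (ho ▸ hqp)
  have h1 : Linked σ (σ ^ m) := linked_pow (ne_one_of_orderOf_prime (ho ▸ hq))
  exact ((h1.trans hl).trans (linked_of_isSwap_of_isSwap (by omega) hρ hτ)).symm

/-- The generated subgroup is invariant along edges: a nontrivial power of an element of order `p`
again has order `p`, and an element with a power of order `p` has order divisible by `p`, so it is
itself a `p`-cycle. -/
theorem zpowers_eq_of_linked_isKCycle {p : ℕ} (hp : p.Prime) (hn : n ≤ p + 1)
    {σ τ : Perm (Fin n)} (hσ : IsKCycle p σ) (h : Linked σ τ) :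
    Subgroup.zpowers τ = Subgroup.zpowers σ := by
  obtain ⟨h1, h2, h⟩ := h
  refine reachable_invariant
    (P := fun v : ({1}ᶜ : Set (Perm (Fin n))) => Subgroup.zpowers v.1 = Subgroup.zpowers σ)
    ?_ h rfl
  rintro ⟨v, hv⟩ ⟨w, hw⟩ ⟨-, hadj⟩ hvσ
  have hvp : orderOf v = p := by
    rw [← Nat.card_zpowers, hvσ, Nat.card_zpowers, hσ.orderOf]
  rw [← hvσ]
  rcases hadj with ⟨m, -, h : w = v ^ m⟩ | ⟨m, -, h : v = w ^ m⟩
  · subst h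
    refine zpowers_pow_eq_of_orderOf_eq v m ?_
    rw [hvp]
    refine ((Nat.dvd_prime hp).1 (hvp ▸ orderOf_pow_dvd m)).resolve_left fun h => ?_
    exact hw (orderOf_eq_one_iff.1 h)
  · subst h
    refine (zpowers_pow_eq_of_orderOf_eq w m ?_).symm
    rw [hvp]
    have : p ∣ orderOf w := hvp ▸ orderOf_pow_dvd m
    exact (isKCycle_of_dvd_orderOf hp hn this).orderOf.symm

theorem ncard_isKCycle {k : ℕ} (hk : 2 ≤ k) (hkn : k ≤ n) :
    {σ : Perm (Fin n) | IsKCycle k σ}.ncard * ((n - k).factorial * k) = n.factorial := by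
  have hset : {σ : Perm (Fin n) | IsKCycle k σ}
      = ((Finset.univ.filter fun σ : Perm (Fin n) => σ.cycleType = {k} : Finset _) : Set _) := by
    ext σ
    simp [isKCycle_iff_cycleType hk]
  rw [hset, Set.ncard_coe_finset]
  have := card_of_cycleType_mul_eq (Fin n) {k}
  rw [if_pos ⟨by simpa using hkn, by simpa using hk⟩] at this
  simpa using this

end Perm

/-! ### The main component and the number of components of `p`-cycles. -/

section Main

open Equiv Equiv.Perm

variable {n p : ℕ}

theorem isSwap_transposition (hn : 2 ≤ n) : (transposition n hn).1.IsSwap :=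
  ⟨_, _, fun h => absurd (congrArg Fin.val h) Nat.zero_ne_one, rfl⟩

theorem exists_isKCycle (hp : p.Prime) (hpn : p ≤ n) : ∃ σ : Perm (Fin n), IsKCycle p σ := by
  by_contra! h
  have := ncard_isKCycle hp.two_le hpn
  rw [show {σ : Perm (Fin n) | IsKCycle p σ} = ∅ from Set.eq_empty_iff_forall_notMem.2 h,
    Set.ncard_empty, zero_mul] at this
  exact n.factorial_ne_zero this.symm

theorem isKCycle_of_zpowers_eq (hp : p.Prime) (hn : n ≤ p + 1) {σ τ : Perm (Fin n)}
    (hσ : IsKCycle p σ) (h : Subgroup.zpowers τ = Subgroup.zpowers σ) : IsKCycle p τ := by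
  rw [isKCycle_iff_orderOf hp hn] at hσ ⊢
  rw [← hσ, ← Nat.card_zpowers, ← Nat.card_zpowers, h]

theorem linked_isKCycle_iff (hp : p.Prime) (hn : n ≤ p + 1) {σ τ : Perm (Fin n)}
    (hσ : IsKCycle p σ) : Linked τ σ ↔ Subgroup.zpowers τ = Subgroup.zpowers σ :=
  ⟨fun h => zpowers_eq_of_linked_isKCycle hp hn hσ h.symm,
    fun h => (linked_of_zpowers_eq hσ.1.ne_one h.symm).symm⟩

theorem linked_transposition_iff (hn2 : 2 ≤ n) (hn : 8 ≤ n) (hp : p.Prime) (hnp : n = p ∨ n = p + 1)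
    (σ : ({1}ᶜ : Set (Perm (Fin n)))) :
    Linked σ.1 (transposition n hn2).1 ↔ ¬ IsKCycle p σ.1 := by
  have ht := isSwap_transposition hn2
  refine ⟨fun h hσ => ?_, fun h => (linked_of_not_isKCycle hn hp hnp σ.2 h ht).symm⟩
  have := isKCycle_of_zpowers_eq hp (by omega) hσ (zpowers_eq_of_linked_isKCycle hp (by omega) hσ h)
  have := this.orderOf
  rw [ht.orderOf] at this
  omega

/-- A type that classifies the `p`-cycles by the cyclic subgroups they generate has
`(n - 2)!` or `n (n - 3)!` elements. -/
theorem card_of_isKCycle_fibers (hp : p.Prime) (hnp : n = p ∨ n = p + 1)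
    {α : Type*} (f : {σ : Perm (Fin n) | IsKCycle p σ} → α) (hf : Function.Surjective f)
    (hfS : ∀ x y, f x = f y ↔ Subgroup.zpowers x.1 = Subgroup.zpowers y.1) :
    (n = p → Nat.card α = (n - 2).factorial) ∧
      (n = p + 1 → Nat.card α = n * (n - 3).factorial) := by
  have h1 := card_mul_pred_of_fibers hp f hf (fun x hx => IsKCycle.orderOf hx)
    (fun x hx y hy => isKCycle_of_zpowers_eq hp (by omega) hx hy) hfS
  have h2 := ncard_isKCycle (n := n) hp.two_le (by omega)
  rw [← h1] at h2
  -- With `q = p - 2` the factor `(p - 1) * p` splits off `p!` without truncated subtraction and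
  -- cancels on both sides.
  obtain ⟨q, rfl⟩ : ∃ q, p = q + 2 := ⟨p - 2, by have := hp.two_le; omega⟩
  have hfac : (q + 2).factorial = q.factorial * ((q + 2 - 1) * (q + 2)) := by
    rw [Nat.factorial_succ, Nat.factorial_succ]
    simp only [show q + 2 - 1 = q + 1 from rfl]
    ring
  have hpos : 0 < (q + 2 - 1) * (q + 2) := Nat.mul_pos (by omega) (by omega)
  constructor
  · rintro rfl
    rw [Nat.sub_self, Nat.factorial_zero, one_mul, hfac, mul_assoc] at h2
    exact Nat.eq_of_mul_eq_mul_right hpos h2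
  · rintro rfl
    rw [Nat.add_sub_cancel_left, Nat.factorial_one, one_mul, Nat.factorial_succ (q + 2), hfac,
      mul_assoc, ← mul_assoc (q + 2 + 1)] at h2
    exact Nat.eq_of_mul_eq_mul_right hpos h2

theorem exists_orderOf_eq_three (hn : 5 ≤ n) :
    ∃ σ : ({1}ᶜ : Set (Perm (Fin n))), orderOf σ.1 = 3 := by
  obtain ⟨ρ, hρ, -⟩ := exists_isThreeCycle_disjoint (n := n) ∅ (by simp; omega)
  exact ⟨⟨ρ, hρ.isCycle.ne_one⟩, hρ.orderOf⟩

theorem orderOf_transposition (hn : 2 ≤ n) : orderOf (transposition n hn).1 = 2 :=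
  (isSwap_transposition hn).orderOf

theorem mem_mainComponent_iff (hn2 : 2 ≤ n) (hn : 8 ≤ n) (hp : p.Prime) (hnp : n = p ∨ n = p + 1)
    (σ : ({1}ᶜ : Set (Perm (Fin n)))) :
    properCls σ ∈ (mainComponent n hn2).supp ↔ ¬ IsKCycle p σ.1 := by
  rw [← linked_transposition_iff hn2 hn hp hnp, linked_coe_iff, ← reachable_properCls_iff]
  exact SimpleGraph.ConnectedComponent.eq

/-! ### The type graph and the order graph as images of the quotient power graph. -/

theorem orderHom_properCls (σ : ({1}ᶜ : Set (Perm (Fin n)))) :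
    (orderHom (Perm (Fin n)) (properCls σ)).1 = orderOf σ.1 := rfl

theorem typeHom_properCls (σ : ({1}ᶜ : Set (Perm (Fin n)))) :
    (typeHom n (properCls σ)).1 = permType σ.1 := rfl

theorem properOrderGraph_not_adj_of_orderOf {a b : ({1}ᶜ : Set (Perm (Fin n)))}
    (ha : orderOf a.1 = 2) (hb : orderOf b.1 = 3) :
    ¬ (properOrderGraph (Perm (Fin n))).Adj (orderHom _ (properCls a))
      (orderHom _ (properCls b)) := by
  rintro ⟨-, h | h⟩
  · simp only [Function.Embedding.subtype_apply, orderHom_properCls, ha, hb] at h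
    omega
  · simp only [Function.Embedding.subtype_apply, orderHom_properCls, ha, hb] at h
    omega

theorem dvd_of_properTypeGraph_adj {a b : ({1}ᶜ : Set (Perm (Fin n)))}
    (h : (properTypeGraph n).Adj (typeHom n (properCls a)) (typeHom n (properCls b))) :
    orderOf a.1 ∣ orderOf b.1 ∨ orderOf b.1 ∣ orderOf a.1 := by
  have key : ∀ {a b : ({1}ᶜ : Set (Perm (Fin n)))} {m : ℕ}, 0 < m →
      permType b.1 = partitionPow (permType a.1) m → orderOf b.1 ∣ orderOf a.1 := by
    intro a b m hm h
    rw [← permType_pow _ hm] at h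
    rw [orderOf_eq_of_permType_eq h]
    exact orderOf_pow_dvd m
  obtain ⟨-, ⟨m, hm, h⟩ | ⟨m, hm, h⟩⟩ := h
  · exact Or.inr (key hm h)
  · exact Or.inl (key hm h)

theorem exists_typeHom_eq (T : (Set.range (permType (n := n)) \ {trivialPartition n} : Set _)) :
    ∃ σ, typeHom n (properCls σ) = T := by
  obtain ⟨_, ⟨σ, rfl⟩, hT⟩ := T
  exact ⟨⟨σ, fun h => hT (permType_eq_trivial_iff.2 h)⟩, rfl⟩

theorem exists_orderHom_eq
    (m : (Set.range (fun x : Perm (Fin n) => orderOf x) \ {1} : Set ℕ)) :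
    ∃ σ, orderHom _ (properCls σ) = m := by
  obtain ⟨_, ⟨σ, rfl⟩, hT⟩ := m
  exact ⟨⟨σ, fun h => hT (orderOf_eq_one_iff.2 h)⟩, rfl⟩

theorem properQuotientPowerGraph_adj_pow {G : Type*} [Group G] [Finite G] {x y : ({1}ᶜ : Set G)}
    {m : ℕ} (hm : 0 < m) (h : y.1 = x.1 ^ m) (ho : orderOf y.1 ≠ orderOf x.1) :
    (properQuotientPowerGraph G).Adj (properCls x) (properCls y) := by
  refine ⟨fun he => ho ?_, x.1, y.1, ⟨fun he => ho (by rw [he]), Or.inl ⟨m, hm, h⟩⟩, rfl, rfl⟩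
  have he' : cls x.1 = cls y.1 := he
  rw [← Nat.card_zpowers, ← Nat.card_zpowers, cls_eq_iff.1 he']

/-- If `σ` has type `S`, then `σ ^ m` has type `S ^ m`, so an edge lifts starting from any
representative of the type whose power is taken. -/
theorem properTypeGraph_adj_lift
    {S T : (Set.range (permType (n := n)) \ {trivialPartition n} : Set _)}
    (h : (properTypeGraph n).Adj S T) :
    ∃ v w, (properQuotientPowerGraph (Perm (Fin n))).Adj v w ∧ typeHom n v = S ∧
      typeHom n w = T := by
  have key : ∀ {S T : (Set.range (permType (n := n)) \ {trivialPartition n} : Set _)} {m : ℕ},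
      0 < m → T.1 = partitionPow S.1 m → S ≠ T →
      ∃ v w, (properQuotientPowerGraph (Perm (Fin n))).Adj v w ∧ typeHom n v = S ∧
        typeHom n w = T := by
    intro S T m hm h hne
    obtain ⟨σ, rfl⟩ := exists_typeHom_eq S
    have hT : permType (σ.1 ^ m) = T.1 := by rw [permType_pow _ hm, h, typeHom_properCls]
    have h1 : σ.1 ^ m ≠ 1 := fun h1 => T.2.2 (by rw [← hT, h1]; exact permType_one)
    refine ⟨properCls σ, properCls ⟨σ.1 ^ m, h1⟩, properQuotientPowerGraph_adj_pow hm rfl ?_, rfl,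
      Subtype.ext hT⟩
    -- Were the orders equal, `σ` and `σ ^ m` would generate the same subgroup and so have the same
    -- type.
    refine fun ho => hne (Subtype.ext ?_)
    rw [← hT, typeHom_properCls]
    exact (permType_eq_of_zpowers_eq (zpowers_pow_eq_of_orderOf_eq σ.1 m ho)).symm
  have hne := h.ne
  obtain ⟨-, ⟨m, hm, h⟩ | ⟨m, hm, h⟩⟩ := h
  · exact key hm h hne
  · obtain ⟨v, w, hvw, hv, hw⟩ := key hm h hne.symm
    exact ⟨w, v, hvw.symm, hw, hv⟩

/-- A divisor of the order of `σ` is the order of a power of `σ`, with the complementary divisor as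
exponent. -/
theorem properOrderGraph_adj_lift
    {a b : (Set.range (fun x : Perm (Fin n) => orderOf x) \ {1} : Set ℕ)}
    (h : (properOrderGraph (Perm (Fin n))).Adj a b) :
    ∃ v w, (properQuotientPowerGraph (Perm (Fin n))).Adj v w ∧ orderHom _ v = a ∧
      orderHom _ w = b := by
  have key : ∀ {a b : (Set.range (fun x : Perm (Fin n) => orderOf x) \ {1} : Set ℕ)},
      b.1 ∣ a.1 → a ≠ b →
      ∃ v w, (properQuotientPowerGraph (Perm (Fin n))).Adj v w ∧ orderHom _ v = a ∧
        orderHom _ w = b := by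
    intro a b h hne
    obtain ⟨σ, rfl⟩ := exists_orderHom_eq a
    obtain ⟨m, hm⟩ := h
    rw [orderHom_properCls] at hm
    have hm0 : 0 < m := by
      rcases Nat.eq_zero_or_pos m with rfl | h
      · exact absurd hm (orderOf_pos σ.1).ne'
      · exact h
    have ho : orderOf (σ.1 ^ m) = b.1 := by
      rw [orderOf_pow_of_dvd hm0.ne' ⟨b.1, by rw [hm, mul_comm]⟩, hm, Nat.mul_div_cancel _ hm0]
    have h1 : σ.1 ^ m ≠ 1 := fun h1 => b.2.2 (by rw [← ho, h1]; exact orderOf_one)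
    refine ⟨properCls σ, properCls ⟨σ.1 ^ m, h1⟩, properQuotientPowerGraph_adj_pow hm0 rfl ?_, rfl,
      Subtype.ext ho⟩
    exact fun h => hne (Subtype.ext (by rw [orderHom_properCls, ← h, ← ho]))
  have hne := h.ne
  obtain ⟨-, h | h⟩ := h
  · obtain ⟨v, w, hvw, hv, hw⟩ := key h hne.symm
    exact ⟨w, v, hvw.symm, hw, hv⟩
  · exact key h hne

/-- If the image under a surjective homomorphism of the class of a `p`-cycle `ι` is isolated and is
the image of `p`-cycles only, the image graph consists of the image of the main component and of
an isolated vertex. -/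
theorem components_of_image (hn2 : 2 ≤ n) (hn : 8 ≤ n) (hp : p.Prime) (hnp : n = p ∨ n = p + 1)
    {V : Type*} {H : SimpleGraph V} (f : properQuotientPowerGraph (Perm (Fin n)) →g H)
    (hsurj : ∀ v, ∃ σ, f (properCls σ) = v)
    (hlift : ∀ a b, H.Adj a b →
      ∃ v w, (properQuotientPowerGraph (Perm (Fin n))).Adj v w ∧ f v = a ∧ f w = b)
    (hord : ∀ σ τ, f (properCls σ) = f (properCls τ) → orderOf σ.1 = orderOf τ.1)
    (hadj : ∀ σ τ, H.Adj (f (properCls σ)) (f (properCls τ)) →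
      orderOf σ.1 ∣ orderOf τ.1 ∨ orderOf τ.1 ∣ orderOf σ.1)
    (hcyc : ∀ σ τ, IsKCycle p σ.1 → IsKCycle p τ.1 → f (properCls σ) = f (properCls τ))
    (ι : ({1}ᶜ : Set (Perm (Fin n)))) (hι : IsKCycle p ι.1) :
    ∃ D I : H.ConnectedComponent,
      D.toSubgraph = (mainComponent n hn2).toSubgraph.map f ∧
      (∀ σ, f (properCls σ) ∈ D.supp ↔ ¬ IsKCycle p σ.1) ∧
      D.toSimpleGraph ≠ ⊤ ∧ I.supp = {f (properCls ι)} ∧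
      I ≠ D ∧ ∀ C : H.ConnectedComponent, C = D ∨ C = I := by
  have hn' : n ≤ p + 1 := by omega
  -- A neighbour comes from some `τ` whose order divides `p` or is divisible by `p`. As `τ` is
  -- nontrivial it is a `p`-cycle, and all `p`-cycles have the same image.
  have hiso : ∀ v, H.Reachable (f (properCls ι)) v → v = f (properCls ι) := by
    intro v h
    refine reachable_invariant (P := fun v => v = f (properCls ι)) ?_ h rfl
    rintro _ w hw rfl
    obtain ⟨τ, rfl⟩ := hsurj w
    have hdvd := hadj _ _ hw
    rw [hι.orderOf] at hdvd
    have hdvd' : p ∣ orderOf τ.1 := by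
      refine hdvd.elim id fun h => ?_
      rw [((Nat.dvd_prime hp).1 h).resolve_left fun h => τ.2 (orderOf_eq_one_iff.1 h)]
    exact hcyc _ _ (isKCycle_of_dvd_orderOf hp hn' hdvd') hι
  set t := transposition n hn2
  have ht : orderOf t.1 = 2 := orderOf_transposition _
  have hmem : ∀ σ, f (properCls σ) ∈ (H.connectedComponentMk (f (properCls t))).supp ↔
      ¬ IsKCycle p σ.1 := by
    intro σ
    rw [SimpleGraph.ConnectedComponent.mem_supp_iff, SimpleGraph.ConnectedComponent.eq]
    constructor
    · intro h hσ
      rw [hcyc σ ι hσ hι] at h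
      have := hord _ _ (hiso _ h)
      rw [ht, hι.orderOf] at this
      omega
    · intro h
      rw [← mem_mainComponent_iff hn2 hn hp hnp] at h
      exact (SimpleGraph.ConnectedComponent.exact h).map f
  obtain ⟨ρ, hρ⟩ := exists_orderOf_eq_three (n := n) (by omega)
  -- From `n ≥ 8` and `n ≤ p + 1` follows `p ≥ 7`, so elements of order 2 and 3 lie in the main
  -- component.
  have hord' : ∀ σ : ({1}ᶜ : Set (Perm (Fin n))), orderOf σ.1 < 7 → ¬ IsKCycle p σ.1 := by
    intro σ h hσ
    rw [hσ.orderOf] at h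
    omega
  have hIsupp : (H.connectedComponentMk (f (properCls ι))).supp = {f (properCls ι)} := by
    ext v
    rw [SimpleGraph.ConnectedComponent.mem_supp_iff, SimpleGraph.ConnectedComponent.eq]
    constructor
    · exact fun h => hiso v h.symm
    · rintro rfl
      rfl
  refine ⟨H.connectedComponentMk (f (properCls t)), H.connectedComponentMk (f (properCls ι)),
    ?_, hmem, ?_, hIsupp, ?_, ?_⟩
  · refine toSubgraph_eq_map f _ _ (fun v => ?_) (fun v => ?_) hlift
    · obtain ⟨σ, rfl⟩ := exists_properCls_eq v
      rw [hmem, mem_mainComponent_iff hn2 hn hp hnp]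
    · obtain ⟨σ, rfl⟩ := hsurj v
      exact ⟨_, rfl⟩
  · refine toSimpleGraph_ne_top _ ((hmem t).2 (hord' t (by omega)))
      ((hmem ρ).2 (hord' ρ (by omega))) (fun h => ?_) (fun h => ?_)
    · have := hord _ _ h
      omega
    · have := hadj _ _ h
      rw [ht, hρ] at this
      omega
  · intro h
    refine (hmem ι).1 ?_ hι
    rw [← h]
    rfl
  · intro C
    induction C using SimpleGraph.ConnectedComponent.ind with
    | h v =>
      obtain ⟨σ, rfl⟩ := hsurj v
      by_cases hσ : IsKCycle p σ.1
      · right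
        rw [hcyc σ ι hσ hι]
      · left
        exact (hmem σ).2 hσ

/-! ### Components of the quotient power graph and of the power graph. -/

theorem permType_parts_of_isKCycle {k : ℕ} (hk : 2 ≤ k) {σ : Perm (Fin n)} (h : IsKCycle k σ) :
    (permType σ).parts = {k} + Multiset.replicate (n - k) 1 := by
  change σ.partition.parts = _
  rw [parts_partition, (isKCycle_iff_cycleType hk).1 h, h.2, Fintype.card_fin]

theorem properQuotientPowerGraph_components (hn2 : 2 ≤ n) (hn : 8 ≤ n) (hp : p.Prime)
    (hnp : n = p ∨ n = p + 1) :
    (mainComponent n hn2).toSimpleGraph ≠ ⊤ ∧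
      (∀ C : (properQuotientPowerGraph (Perm (Fin n))).ConnectedComponent,
        C ≠ mainComponent n hn2 → ∃ v, C.supp = {v}) ∧
      (n = p → Nat.card {C : (properQuotientPowerGraph (Perm (Fin n))).ConnectedComponent //
          C ≠ mainComponent n hn2} = (n - 2).factorial) ∧
      (n = p + 1 → Nat.card {C : (properQuotientPowerGraph (Perm (Fin n))).ConnectedComponent //
          C ≠ mainComponent n hn2} = n * (n - 3).factorial) := by
  have hn' : n ≤ p + 1 := by omega
  have hne : ∀ C : (properQuotientPowerGraph (Perm (Fin n))).ConnectedComponent,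
      C ≠ mainComponent n hn2 → ∃ σ : ({1}ᶜ : Set (Perm (Fin n))), IsKCycle p σ.1 ∧
        SimpleGraph.connectedComponentMk _ (properCls σ) = C := by
    intro C hC
    induction C using SimpleGraph.ConnectedComponent.ind with
    | h v =>
      obtain ⟨σ, rfl⟩ := exists_properCls_eq v
      refine ⟨σ, ?_, rfl⟩
      by_contra h
      exact hC ((mem_mainComponent_iff hn2 hn hp hnp σ).2 h)
  -- This one equivalence shows both that a component of `p`-cycles is a single class and that such
  -- components are counted by subgroups of order `p`.
  have heq : ∀ σ τ : ({1}ᶜ : Set (Perm (Fin n))), IsKCycle p τ.1 →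
      ((properQuotientPowerGraph (Perm (Fin n))).connectedComponentMk (properCls σ) =
        (properQuotientPowerGraph (Perm (Fin n))).connectedComponentMk (properCls τ) ↔
        Subgroup.zpowers σ.1 = Subgroup.zpowers τ.1) := by
    intro σ τ hτ
    rw [SimpleGraph.ConnectedComponent.eq, reachable_properCls_iff, ← linked_coe_iff,
      linked_isKCycle_iff hp hn' hτ]
  refine ⟨?_, fun C hC => ?_, ?_⟩
  · obtain ⟨ρ, hρ⟩ := exists_orderOf_eq_three (n := n) (by omega)
    have ht := orderOf_transposition hn2
    refine toSimpleGraph_ne_top _ (v := properCls (transposition n hn2)) (w := properCls ρ)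
      rfl ?_ ?_ ?_
    · rw [mem_mainComponent_iff hn2 hn hp hnp]
      intro h
      have := h.orderOf
      omega
    · intro h
      have : orderOf _ = orderOf _ := congrArg Subtype.val (congrArg (orderHom _) h)
      omega
    · exact fun h => properOrderGraph_not_adj_of_orderOf ht hρ ((orderHom _).map_adj h)
  · obtain ⟨σ, hσ, rfl⟩ := hne C hC
    refine ⟨properCls σ, Set.ext fun v => ?_⟩
    obtain ⟨τ, rfl⟩ := exists_properCls_eq v
    rw [SimpleGraph.ConnectedComponent.mem_supp_iff, heq _ _ hσ, ← cls_eq_iff,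
      Set.mem_singleton_iff]
    exact ⟨fun h => Subtype.ext h, fun h => congrArg Subtype.val h⟩
  · refine card_of_isKCycle_fibers hp hnp
      (fun σ => ⟨SimpleGraph.connectedComponentMk _ (properCls ⟨σ.1, σ.2.1.ne_one⟩), fun h =>
        (mem_mainComponent_iff hn2 hn hp hnp ⟨σ.1, σ.2.1.ne_one⟩).1 h σ.2⟩) ?_ ?_
    · rintro ⟨C, hC⟩
      obtain ⟨σ, hσ, rfl⟩ := hne C hC
      exact ⟨⟨σ.1, hσ⟩, rfl⟩
    · intro σ τ
      rw [Subtype.mk.injEq]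
      exact heq ⟨σ.1, σ.2.1.ne_one⟩ ⟨τ.1, τ.2.1.ne_one⟩ τ.2

theorem properPowerGraph_components (hn : 8 ≤ n) (hp : p.Prime) (hnp : n = p ∨ n = p + 1) :
    ∃ D : (properPowerGraph (Perm (Fin n))).ConnectedComponent,
      (∀ ψ, ψ ∈ D.supp ↔ ¬ IsKCycle p ψ.1) ∧
      D.toSimpleGraph ≠ ⊤ ∧
      (∀ C : (properPowerGraph (Perm (Fin n))).ConnectedComponent,
        C ≠ D → (∀ ψ ∈ C.supp, IsKCycle p ψ.1) ∧
          C.supp.ncard = p - 1 ∧ C.toSimpleGraph = ⊤) ∧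
      (n = p → Nat.card {C : (properPowerGraph
          (Perm (Fin n))).ConnectedComponent // C ≠ D} = (n - 2).factorial) ∧
      (n = p + 1 → Nat.card {C : (properPowerGraph
          (Perm (Fin n))).ConnectedComponent // C ≠ D} = n * (n - 3).factorial) := by
  have hn' : n ≤ p + 1 := by omega
  have hn2 : 2 ≤ n := by omega
  set t := transposition n hn2
  have ht : orderOf t.1 = 2 := orderOf_transposition _
  have hmem : ∀ σ, σ ∈ ((properPowerGraph (Perm (Fin n))).connectedComponentMk t).supp ↔
      ¬ IsKCycle p σ.1 := by
    intro σ
    rw [SimpleGraph.ConnectedComponent.mem_supp_iff, SimpleGraph.ConnectedComponent.eq,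
      ← linked_coe_iff, linked_transposition_iff hn2 hn hp hnp]
  have hne : ∀ C : (properPowerGraph (Perm (Fin n))).ConnectedComponent,
      C ≠ SimpleGraph.connectedComponentMk _ t → ∃ σ : ({1}ᶜ : Set (Perm (Fin n))),
        IsKCycle p σ.1 ∧ SimpleGraph.connectedComponentMk _ σ = C := by
    intro C hC
    induction C using SimpleGraph.ConnectedComponent.ind with
    | h σ =>
      refine ⟨σ, ?_, rfl⟩
      by_contra h
      exact hC ((hmem σ).2 h)
  have heq : ∀ σ τ : ({1}ᶜ : Set (Perm (Fin n))), IsKCycle p τ.1 →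
      ((properPowerGraph (Perm (Fin n))).connectedComponentMk σ =
        (properPowerGraph (Perm (Fin n))).connectedComponentMk τ ↔
        Subgroup.zpowers σ.1 = Subgroup.zpowers τ.1) := by
    intro σ τ hτ
    rw [SimpleGraph.ConnectedComponent.eq, ← linked_coe_iff, linked_isKCycle_iff hp hn' hτ]
  refine ⟨SimpleGraph.connectedComponentMk _ t, hmem, ?_, fun C hC => ?_, ?_⟩
  · obtain ⟨ρ, hρ⟩ := exists_orderOf_eq_three (n := n) (by omega)
    refine toSimpleGraph_ne_top _ (v := t) (w := ρ) rfl ?_ ?_ ?_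
    · rw [hmem]
      intro h
      have := h.orderOf
      omega
    · intro h
      rw [h] at ht
      omega
    · rintro ⟨-, ⟨m, -, h⟩ | ⟨m, -, h⟩⟩
      · have := orderOf_pow_dvd (x := t.1) m
        rw [← show ρ.1 = t.1 ^ m from h, ht, hρ] at this
        omega
      · have := orderOf_pow_dvd (x := ρ.1) m
        rw [← show t.1 = ρ.1 ^ m from h, ht, hρ] at this
        omega
  · obtain ⟨σ, hσ, rfl⟩ := hne C hC
    have hsupp : ∀ ψ, ψ ∈ ((properPowerGraph (Perm (Fin n))).connectedComponentMk σ).supp ↔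
        Subgroup.zpowers ψ.1 = Subgroup.zpowers σ.1 := fun ψ => heq ψ σ hσ
    refine ⟨fun ψ hψ => isKCycle_of_zpowers_eq hp hn' hσ ((hsupp ψ).1 hψ), ?_, ?_⟩
    -- Viewed inside the whole group, the component is the set of generators of `⟨σ⟩`.
    · rw [← ncard_zpowers_eq hp hσ.orderOf, ← Set.ncard_image_of_injective _ Subtype.val_injective]
      congr 1
      ext ψ
      constructor
      · rintro ⟨ψ, hψ, rfl⟩
        exact (hsupp ψ).1 hψ
      · intro hψ
        have hψ1 := (isKCycle_of_zpowers_eq hp hn' hσ hψ).1.ne_one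
        exact ⟨⟨ψ, hψ1⟩, (hsupp _).2 hψ, rfl⟩
    · ext ⟨u, hu⟩ ⟨v, hv⟩
      rw [SimpleGraph.top_adj, SimpleGraph.ConnectedComponent.toSimpleGraph_adj]
      refine ⟨fun h he => h.ne (congrArg Subtype.val he), fun h => ⟨fun he => h ?_, Or.inl ?_⟩⟩
      · exact Subtype.ext (Subtype.ext he)
      -- Any two vertices generate the same subgroup, so each is a power of the other; the exponent
      -- is positive because `v ≠ 1`.
      · have huv : v.1 ∈ Subgroup.zpowers u.1 := by
          rw [(hsupp u).1 hu, ← (hsupp v).1 hv]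
          exact Subgroup.mem_zpowers _
        obtain ⟨m, hm⟩ := (mem_powers_iff_mem_zpowers (x := u.1)).2 huv
        refine ⟨m, Nat.pos_of_ne_zero ?_, hm.symm⟩
        rintro rfl
        exact v.2 hm.symm
  · refine card_of_isKCycle_fibers hp hnp
      (fun σ => ⟨SimpleGraph.connectedComponentMk _ ⟨σ.1, σ.2.1.ne_one⟩, fun h =>
        (hmem ⟨σ.1, σ.2.1.ne_one⟩).1 h σ.2⟩) ?_ ?_
    · rintro ⟨C, hC⟩
      obtain ⟨σ, hσ, rfl⟩ := hne C hC
      exact ⟨⟨σ.1, hσ⟩, rfl⟩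
    · intro σ τ
      rw [Subtype.mk.injEq]
      exact heq ⟨σ.1, σ.2.1.ne_one⟩ ⟨τ.1, τ.2.1.ne_one⟩ τ.2

end Main
end PowerGraphs

theorem theoremD (n p : ℕ) (hn : 8 ≤ n) (hp : p.Prime) (hnp : n = p ∨ n = p + 1) :
    -- the proper quotient power graph
    ((∀ ψ : ({1}ᶜ : Set (Equiv.Perm (Fin n))),
        PowerGraphs.properCls ψ ∈ (PowerGraphs.mainComponent n (by omega)).supp ↔
          ¬ PowerGraphs.IsKCycle p ψ.1) ∧
      (PowerGraphs.mainComponent n (by omega)).toSimpleGraph ≠ ⊤ ∧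
      (∀ C : (PowerGraphs.properQuotientPowerGraph (Equiv.Perm (Fin n))).ConnectedComponent,
        C ≠ PowerGraphs.mainComponent n (by omega) → ∃ v, C.supp = {v}) ∧
      (n = p →
        Nat.card {C : (PowerGraphs.properQuotientPowerGraph
            (Equiv.Perm (Fin n))).ConnectedComponent //
          C ≠ PowerGraphs.mainComponent n (by omega)} = (n - 2).factorial) ∧
      (n = p + 1 →
        Nat.card {C : (PowerGraphs.properQuotientPowerGraph
            (Equiv.Perm (Fin n))).ConnectedComponent //
          C ≠ PowerGraphs.mainComponent n (by omega)} = n * (n - 3).factorial)) ∧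
    -- the proper power graph
    (∃ D : (PowerGraphs.properPowerGraph (Equiv.Perm (Fin n))).ConnectedComponent,
      D.supp = {ψ | PowerGraphs.properCls ψ ∈
        (PowerGraphs.mainComponent n (by omega)).supp} ∧
      (∀ ψ : ({1}ᶜ : Set (Equiv.Perm (Fin n))),
        ψ ∈ D.supp ↔ ¬ PowerGraphs.IsKCycle p ψ.1) ∧
      D.toSimpleGraph ≠ ⊤ ∧
      (∀ C : (PowerGraphs.properPowerGraph (Equiv.Perm (Fin n))).ConnectedComponent,
        C ≠ D → (∀ ψ ∈ C.supp, PowerGraphs.IsKCycle p ψ.1) ∧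
          C.supp.ncard = p - 1 ∧ C.toSimpleGraph = ⊤) ∧
      (n = p →
        Nat.card {C : (PowerGraphs.properPowerGraph
          (Equiv.Perm (Fin n))).ConnectedComponent // C ≠ D} = (n - 2).factorial) ∧
      (n = p + 1 →
        Nat.card {C : (PowerGraphs.properPowerGraph
          (Equiv.Perm (Fin n))).ConnectedComponent // C ≠ D} = n * (n - 3).factorial)) ∧
    -- the proper power type graph
    (∃ D I : (PowerGraphs.properTypeGraph n).ConnectedComponent,
      D.toSubgraph = (PowerGraphs.mainComponent n (by omega)).toSubgraph.map
        (PowerGraphs.typeHom n) ∧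
      (∀ ψ : ({1}ᶜ : Set (Equiv.Perm (Fin n))),
        PowerGraphs.typeHom n (PowerGraphs.properCls ψ) ∈ D.supp ↔
          ¬ PowerGraphs.IsKCycle p ψ.1) ∧
      D.toSimpleGraph ≠ ⊤ ∧
      (∃ T, I.supp = {T} ∧
        (n = p → T.1.parts = {p}) ∧ (n = p + 1 → T.1.parts = {1, p})) ∧
      I ≠ D ∧ ∀ C : (PowerGraphs.properTypeGraph n).ConnectedComponent, C = D ∨ C = I) ∧
    -- the proper order graph
    (∃ D I : (PowerGraphs.properOrderGraph (Equiv.Perm (Fin n))).ConnectedComponent,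
      D.toSubgraph = (PowerGraphs.mainComponent n (by omega)).toSubgraph.map
        (PowerGraphs.orderHom (Equiv.Perm (Fin n))) ∧
      (∀ ψ : ({1}ᶜ : Set (Equiv.Perm (Fin n))),
        PowerGraphs.orderHom (Equiv.Perm (Fin n)) (PowerGraphs.properCls ψ) ∈ D.supp ↔
          orderOf ψ.1 ≠ p) ∧
      D.toSimpleGraph ≠ ⊤ ∧
      (∃ m, I.supp = {m} ∧ m.1 = p) ∧
      I ≠ D ∧ ∀ C : (PowerGraphs.properOrderGraph
        (Equiv.Perm (Fin n))).ConnectedComponent, C = D ∨ C = I) := by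
  have hn' : n ≤ p + 1 := by omega
  obtain ⟨ι, hι⟩ := PowerGraphs.exists_isKCycle (n := n) hp (by omega)
  have hι1 : ι ∈ ({1}ᶜ : Set (Equiv.Perm (Fin n))) := hι.1.ne_one
  have hmem := PowerGraphs.mem_mainComponent_iff (by omega) hn hp hnp
  refine ⟨⟨hmem, PowerGraphs.properQuotientPowerGraph_components (by omega) hn hp hnp⟩, ?_, ?_, ?_⟩
  · obtain ⟨D, hD, h⟩ := PowerGraphs.properPowerGraph_components hn hp hnp
    refine ⟨D, Set.ext fun ψ => ?_, hD, h⟩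
    rw [hD, Set.mem_ofPred_eq, hmem]
  · obtain ⟨D, I, h1, h2, h3, h4, h5⟩ := PowerGraphs.components_of_image (by omega) hn hp hnp
      (PowerGraphs.typeHom n) PowerGraphs.exists_typeHom_eq
      (fun _ _ => PowerGraphs.properTypeGraph_adj_lift)
      (fun σ τ h => PowerGraphs.orderOf_eq_of_permType_eq (congrArg Subtype.val h))
      (fun _ _ => PowerGraphs.dvd_of_properTypeGraph_adj)
      (fun σ τ hσ hτ => Subtype.ext (Nat.Partition.ext (by
        rw [PowerGraphs.typeHom_properCls, PowerGraphs.typeHom_properCls,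
          PowerGraphs.permType_parts_of_isKCycle hp.two_le hσ,
          PowerGraphs.permType_parts_of_isKCycle hp.two_le hτ]))) ⟨ι, hι1⟩ hι
    refine ⟨D, I, h1, h2, h3, ⟨_, h4, ?_⟩, h5⟩
    rw [PowerGraphs.typeHom_properCls, PowerGraphs.permType_parts_of_isKCycle hp.two_le hι]
    constructor
    · rintro rfl
      simp
    · rintro rfl
      rw [Nat.add_sub_cancel_left, Multiset.replicate_one, add_comm]
      rfl
  · obtain ⟨D, I, h1, h2, h3, h4, h5⟩ := PowerGraphs.components_of_image (by omega) hn hp hnp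
      (PowerGraphs.orderHom (Equiv.Perm (Fin n))) PowerGraphs.exists_orderHom_eq
      (fun _ _ => PowerGraphs.properOrderGraph_adj_lift)
      (fun σ τ h => congrArg Subtype.val h)
      (fun _ _ h => h.2)
      (fun σ τ hσ hτ => Subtype.ext (hσ.orderOf.trans hτ.orderOf.symm)) ⟨ι, hι1⟩ hι
    refine ⟨D, I, h1, fun ψ => ?_, h3, ⟨_, h4, hι.orderOf⟩, h5⟩
    rw [h2, PowerGraphs.isKCycle_iff_orderOf hp hn']
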